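/- Graphs are loopless multigraphs (parallel edges are allowed) with a finite, nonempty vertex set. For a graph $G$ and $S\subseteq V(G)$, let $G\setminus S$ be the graph obtained by deleting the vertices of $S$, and let $\omega(G\setminus S)$ be its number of connected components (so $\omega=0$ when $S=V(G)$). A closed walk is a sequence $v_0e_1v_1\dots e_kv_k$ with $k\ge 0$ and $v_k=v_0$, in which each $e_i$ is an edge of $G$ with ends $v_{i-1}$ and $v_i$, and vertices and edges may be repeated. For $k\ge 1$ it meets a vertex $v$ exactly $|\{i: 1\le i\le k,\ v_i=v\}|$ times, and for $k=0$ it meets $v_0$ once and no other vertex. It is spanning if every vertex of $G$ occurs in it. For a positive integer-valued function $f$ on $V(G)$, an $f$-walk is a spanning closed walk that meets each vertex $v$ at most $f(v)$ times; for a positive integer $n$, an $n$-walk is an $f$-walk with $f$ constantly equal to $n$. For a real number $t>0$, $G$ is $t$-tough if $\omega(G\setminus S)\le \max\{1,\tfrac1t|S|\}$ for all $S\subseteq V(G)$. A matching is a set of edges no two of which share an end. **Theorem.** Let $G$ be a graph. (1) Let $f$ be a positive integer-valued function on $V(G)$. If $$\omega(G\setminus S)\le \sum_{v\in S}\bigl(f(v)-1\bigr)+1\qquad\text{for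 all } S\subseteq V(G),$$ then for every matching $M$ of $G$ there is an $f$-walk in $G$ that passes through every edge of $M$. (2) Let $n\ge 2$ be an integer. If $G$ is $\frac{1}{n-1}$-tough, then $G$ has an $n$-walk. -/

import Mathlib

/-!
Loopless multigraphs are Mathlib's `Graph α β` with `Graph.Loopless`; parallel edges are allowed,
and deletion of vertices is `Graph.deleteVerts`.
-/

namespace Graph

variable {α β : Type*}

/-- The number of connected components: the number of classes of the equivalence relation on the
vertex set that is generated by adjacency. -/
noncomputable def numComponents (G : Graph α β) : ℕ :=
  Nat.card (Quot fun x y : G.vertexSet => G.Adj x y)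

/-- A walk `v₀ e₁ v₁ … eₖ vₖ` in a multigraph; vertices and edges may be repeated. -/
inductive Walk (G : Graph α β) : α → α → Type _
  | nil {x : α} (hx : x ∈ G.vertexSet) : Walk G x x
  | cons {x y z : α} (e : β) (h : G.IsLink e x y) (p : Walk G y z) : Walk G x z

namespace Walk

variable {G : Graph α β}

/-- The list of vertices `v₀, …, vₖ` of a walk. -/
def support : {x y : α} → G.Walk x y → List α
  | x, _, nil _ => [x]
  | x, _, cons _ _ p => x :: p.support

/-- The list of edges `e₁, …, eₖ` of a walk. -/
def edges : {x y : α} → G.Walk x y → List β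
  | _, _, nil _ => []
  | _, _, cons e _ p => e :: p.edges

/-- The vertices `v₁, …, vₖ` met by a closed walk `v₀ e₁ v₁ … eₖ vₖ = v₀` with `k ≥ 1`, in cyclic
order, so that the coinciding first and last vertices count only once. The walk of length `0`
meets its only vertex once. (To be used for closed walks.) -/
def cyclicSupport : {x y : α} → G.Walk x y → List α
  | x, _, nil _ => [x]
  | _, _, cons _ _ p => p.support

open Classical in
/-- The number of times that a closed walk meets the vertex `v`. -/
noncomputable def meetCount {x : α} (w : G.Walk x x) (v : α) : ℕ :=
  w.cyclicSupport.count v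

/-- An `f`-walk: a spanning closed walk that meets each vertex `v` at most `f v` times. -/
structure IsFWalk {x : α} (w : G.Walk x x) (f : α → ℕ) : Prop where
  spanning : ∀ v ∈ G.vertexSet, v ∈ w.support
  meetCount_le : ∀ v ∈ G.vertexSet, w.meetCount v ≤ f v

end Walk

/-- A matching: a set of edges of `G` no two of which share an end. (To be used for loopless
graphs.) -/
structure IsEdgeMatching (G : Graph α β) (M : Set β) : Prop where
  subset : M ⊆ G.edgeSet
  eq_of_inc : ∀ e ∈ M, ∀ e' ∈ M, ∀ v, G.Inc e v → G.Inc e' v → e = e'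

/-- A graph with finitely many vertices is `t`-tough, for a positive real `t`, if
`ω(G ∖ S) ≤ max {1, |S| / t}` for every set `S` of vertices. -/
def IsTough (G : Graph α β) (t : ℝ) : Prop :=
  ∀ S : Finset α, (S : Set α) ⊆ G.vertexSet →
    ((G.deleteVerts (S : Set α)).numComponents : ℝ) ≤ max 1 (1 / t * (S.card : ℝ))

end Graph

/-!
Let `H` be the simple graph of adjacency of `G`. It suffices to find a connected multigraph on the
edges of `H`, containing `M`, all of whose degrees are even and at most `2 f`: its Euler tour meets
each vertex `v` at most `f v` times.

First, there is a spanning tree `T ⊇ M` of `H` with degrees at most `f + 1`. Among the connected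
graphs between `M` and `H` take one with the least total excess of the degrees over `f + 1`, and let
`T ⊇ M` be a spanning tree of it. Call `D` a barrier if the vertices of `D` have degree at least
`f + 1`, the others have degree at most `f + 1`, and each of the latter can be brought below `f + 1`
by rearranging `T` inside its component of `T ∖ D`. Take a barrier `D` of minimum size. Suppose that
an edge `xy` of `H` joins two components of `T ∖ D`. The path of `T` from `x` to `y` meets `D`; at
any vertex `z ∈ D` on it, lower the degrees of `x` and `y` inside their components, add `xy`, and
delete an edge of the path at `z` that is not in `M`. This lowers the excess if `z` exceeds its
bound; if no `z` does, the vertices of the path can be removed from `D`, against minimality. So the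
components of `T ∖ D` are not joined by edges of `H`. If `D ≠ ∅`, counting the edges of the tree
gives `ω(T ∖ D) ≥ ∑_{v ∈ D} (f v - 1) + 2`, contradicting the hypothesis. Hence `D = ∅`.

Second, the degrees of `T` are made even. Replace each vertex `v` of `H` by a clique of
`h v = 2 f v - deg_T v ≥ f v - 1` copies. By hypothesis, deleting a set `X` of copies leaves at most
`|X| + 1` components, and hence, by parity, at most `|X|` odd ones; so Tutte's theorem yields a
perfect matching. Projected to `H`, it is a multiset `J` of edges of `H` whose degrees are at most
`h` and congruent to `h` modulo `2`, and `T + J` is the required multigraph.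
-/

namespace FWalk

open SimpleGraph

variable {V : Type*}

/-- `b` can be reached from `a` in `G` by a walk all of whose vertices, its ends included, lie
in `K`. -/
def ReachableIn (G : SimpleGraph V) (K : Set V) (a b : V) : Prop :=
  ∃ p : G.Walk a b, ∀ v ∈ p.support, v ∈ K

namespace ReachableIn

variable {G G' : SimpleGraph V} {K K' : Set V} {a b c : V}

theorem refl (ha : a ∈ K) : ReachableIn G K a a :=
  ⟨.nil, by simpa using ha⟩

theorem symm : ReachableIn G K a b → ReachableIn G K b a
  | ⟨p, hp⟩ => ⟨p.reverse, by simpa using hp⟩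

theorem trans : ReachableIn G K a b → ReachableIn G K b c → ReachableIn G K a c
  | ⟨p, hp⟩, ⟨q, hq⟩ =>
    ⟨p.append q, fun v hv => ((Walk.mem_support_append_iff _ _).1 hv).elim (hp v) (hq v)⟩

theorem mono (hG : G ≤ G') (hK : K ⊆ K') : ReachableIn G K a b → ReachableIn G' K' a b
  | ⟨p, hp⟩ => ⟨p.mapLe hG, fun v hv => hK (hp v (by simpa using hv))⟩

theorem left_mem : ReachableIn G K a b → a ∈ K
  | ⟨p, hp⟩ => hp a p.start_mem_support

theorem right_mem : ReachableIn G K a b → b ∈ K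
  | ⟨p, hp⟩ => hp b p.end_mem_support

theorem of_adj (h : G.Adj a b) (ha : a ∈ K) (hb : b ∈ K) : ReachableIn G K a b :=
  ⟨h.toWalk, by simp [ha, hb]⟩

theorem of_forall_adj (h : ∀ a ∈ K, ∀ b ∈ K, G.Adj a b → ReachableIn G' K a b)
    (hab : ReachableIn G K a b) : ReachableIn G' K a b := by
  obtain ⟨p, hp⟩ := hab
  induction p with
  | nil => exact refl (hp _ (by simp))
  | cons hadj p ih =>
    exact (h _ (hp _ (by simp)) _ (hp _ (by simp)) hadj).trans (ih fun v hv => hp v (by simp [hv]))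

theorem induce_reachable (h : ReachableIn G K a b) :
    (G.induce K).Reachable ⟨a, h.left_mem⟩ ⟨b, h.right_mem⟩ :=
  let ⟨p, hp⟩ := h
  ⟨p.induce K hp⟩

end ReachableIn

theorem reachableIn_univ_iff {G : SimpleGraph V} {a b : V} :
    ReachableIn G Set.univ a b ↔ G.Reachable a b :=
  ⟨fun ⟨p, _⟩ => ⟨p⟩, fun ⟨p⟩ => ⟨p, fun _ _ => Set.mem_univ _⟩⟩

theorem reachableIn_deleteEdges_of_isTrail {G : SimpleGraph V} {K : Set V} {x y z a : V}
    {q : G.Walk x z} {h : G.Adj z a} {r : G.Walk a y} (hp : (q.append (.cons h r)).IsTrail)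
    (hK : ∀ v ∈ (q.append (.cons h r)).support, v ∈ K) :
    ReachableIn (G.deleteEdges {s(z, a)}) K x z ∧ ReachableIn (G.deleteEdges {s(z, a)}) K a y := by
  have hnodup := hp.edges_nodup
  rw [Walk.edges_append, Walk.edges_cons, List.nodup_append] at hnodup
  obtain ⟨-, hcons, hdisj⟩ := hnodup
  have hsupp : ∀ v, v ∈ q.support ∨ v ∈ r.support → v ∈ K := fun v hv =>
    hK v ((Walk.mem_support_append_iff _ _).2 (hv.imp_right fun hv => by simp [hv]))
  refine ⟨⟨q.toDeleteEdges _ fun e he he' => hdisj e he _ List.mem_cons_self he', fun v hv => ?_⟩,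
    ⟨r.toDeleteEdges _ fun e he he' => (List.nodup_cons.1 hcons).1 ?_, fun v hv => ?_⟩⟩
  · exact hsupp v (.inl (by simpa using hv))
  · rwa [← Set.mem_singleton_iff.1 he']
  · exact hsupp v (.inr (by simpa using hv))

/-- `T'` arises from `T` by changing edges inside `K` only, in such a way that vertices of `K` that
were joined by an edge inside `K` are still connected inside `K`. -/
structure IsRearrangement (T T' : SimpleGraph V) (K : Set V) : Prop where
  adj_iff : ∀ a b, ¬(a ∈ K ∧ b ∈ K) → (T'.Adj a b ↔ T.Adj a b)
  reachableIn : ∀ a ∈ K, ∀ b ∈ K, T.Adj a b → ReachableIn T' K a b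

namespace IsRearrangement

variable {T T' T'' : SimpleGraph V} {K X : Set V}

theorem refl (T : SimpleGraph V) (K : Set V) : IsRearrangement T T K :=
  ⟨fun _ _ _ => Iff.rfl, fun _ ha _ hb h => .of_adj h ha hb⟩

theorem mono (h : IsRearrangement T T' X) (hX : X ⊆ K) : IsRearrangement T T' K := by
  refine ⟨fun a b hab => h.adj_iff a b fun hab' => hab ⟨hX hab'.1, hX hab'.2⟩,
    fun a ha b hb hadj => ?_⟩
  by_cases hab : a ∈ X ∧ b ∈ X
  · exact (h.reachableIn a hab.1 b hab.2 hadj).mono le_rfl hX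
  · exact .of_adj ((h.adj_iff a b hab).2 hadj) ha hb

theorem trans (h : IsRearrangement T T' K) (h' : IsRearrangement T' T'' K) :
    IsRearrangement T T'' K :=
  ⟨fun a b hab => (h'.adj_iff a b hab).trans (h.adj_iff a b hab),
    fun a ha b hb hadj => (h.reachableIn a ha b hb hadj).of_forall_adj h'.reachableIn⟩

theorem connected (h : IsRearrangement T T' K) (hT : T.Connected) : T'.Connected := by
  have := hT.nonempty
  exact ⟨fun a b => reachableIn_univ_iff.1 <| (reachableIn_univ_iff.2 (hT.preconnected a b))
    |>.of_forall_adj (h.mono (Set.subset_univ K)).reachableIn⟩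

theorem deleteEdges (h : IsRearrangement T T' X) {z z' : V} (hz : z ∉ X) :
    IsRearrangement (T.deleteEdges {s(z, z')}) (T'.deleteEdges {s(z, z')}) X := by
  refine ⟨fun a b hab => by simp [h.adj_iff a b hab], fun a ha b hb hadj => ?_⟩
  refine (h.reachableIn a ha b hb (deleteEdges_adj.1 hadj).1).of_forall_adj
    fun c hc d hd hcd => .of_adj (deleteEdges_adj.2 ⟨hcd, fun he => ?_⟩) hc hd
  rcases Sym2.eq_iff.1 (Set.mem_singleton_iff.1 he) with ⟨rfl, -⟩ | ⟨-, rfl⟩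
  · exact hz hc
  · exact hz hd

theorem neighborSet_eq (h : IsRearrangement T T' K) {u : V} (hu : u ∉ K) :
    T'.neighborSet u = T.neighborSet u :=
  Set.ext fun b => h.adj_iff u b fun hub => hu hub.1

open scoped Classical in
theorem degree_eq [Fintype V] (h : IsRearrangement T T' K) {u : V} (hu : u ∉ K) :
    T'.degree u = T.degree u := by
  simp only [← card_neighborSet_eq_degree, h.neighborSet_eq hu]

end IsRearrangement

theorem isRearrangement_deleteEdges_sup_edge {T : SimpleGraph V} {K : Set V} {x y z z' : V}
    (hxz : ReachableIn (T.deleteEdges {s(z, z')}) K x z)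
    (hyz : ReachableIn (T.deleteEdges {s(z, z')}) K z' y) :
    IsRearrangement T (T.deleteEdges {s(z, z')} ⊔ edge x y) K := by
  have hle : T.deleteEdges {s(z, z')} ≤ T.deleteEdges {s(z, z')} ⊔ edge x y := le_sup_left
  have hx := hxz.left_mem
  have hy := hyz.right_mem
  have hz := hxz.right_mem
  have hz' := hyz.left_mem
  have hxy : ReachableIn (T.deleteEdges {s(z, z')} ⊔ edge x y) K x y := by
    rcases eq_or_ne x y with rfl | hne
    · exact .refl hx
    · exact .of_adj (.inr (by simp [edge_adj, hne])) hx hy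
  have hzz' : ReachableIn (T.deleteEdges {s(z, z')} ⊔ edge x y) K z z' :=
    ((hxz.mono hle le_rfl).symm.trans hxy).trans (hyz.mono hle le_rfl).symm
  refine ⟨fun a b hab => ?_, fun a ha b hb hadj => ?_⟩
  · have h₁ : s(a, b) ≠ s(z, z') := fun he => by
      rcases Sym2.eq_iff.1 he with ⟨rfl, rfl⟩ | ⟨rfl, rfl⟩ <;> tauto
    have h₂ : s(x, y) ≠ s(a, b) := fun he => by
      rcases Sym2.eq_iff.1 he with ⟨rfl, rfl⟩ | ⟨rfl, rfl⟩ <;> tauto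
    simp [adj_edge, h₁, h₂]
  · by_cases he : s(a, b) = s(z, z')
    · rcases Sym2.eq_iff.1 he with ⟨rfl, rfl⟩ | ⟨rfl, rfl⟩
      · exact hzz'
      · exact hzz'.symm
    · exact .of_adj (hle (deleteEdges_adj.2 ⟨hadj, he⟩)) ha hb

/-- The graph that agrees with `B` inside `Y` and with `A` elsewhere. -/
def replaceOn (A B : SimpleGraph V) (Y : Set V) : SimpleGraph V where
  Adj a b := (a ∈ Y ∧ b ∈ Y ∧ B.Adj a b) ∨ (¬(a ∈ Y ∧ b ∈ Y) ∧ A.Adj a b)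
  symm := ⟨fun a b => by simp only [A.adj_comm a b, B.adj_comm a b]; tauto⟩
  loopless := ⟨fun a => by simp⟩

theorem replaceOn_mem_Icc {M H A B : SimpleGraph V} (hA : A ∈ Set.Icc M H) (hB : B ∈ Set.Icc M H)
    (Y : Set V) : replaceOn A B Y ∈ Set.Icc M H := by
  refine ⟨fun a b hab => ?_, fun a b hab => hab.elim (fun h => hB.2 h.2.2) fun h => hA.2 h.2⟩
  by_cases h : a ∈ Y ∧ b ∈ Y
  · exact .inl ⟨h.1, h.2, hB.1 hab⟩
  · exact .inr ⟨h, hA.1 hab⟩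

namespace IsRearrangement

variable {T A B : SimpleGraph V} {X Y : Set V}

theorem replaceOn_left (hA : IsRearrangement T A X) (hB : IsRearrangement T B Y)
    (hXY : Disjoint X Y) : IsRearrangement A (replaceOn A B Y) Y := by
  refine ⟨fun a b hab => by simp only [replaceOn]; tauto, fun a ha b hb hadj => ?_⟩
  have hab : ¬(a ∈ X ∧ b ∈ X) := fun h => Set.disjoint_left.1 hXY h.1 ha
  exact (hB.reachableIn a ha b hb ((hA.adj_iff a b hab).1 hadj)).of_forall_adj
    fun c hc d hd hcd => .of_adj (.inl ⟨hc, hd, hcd⟩) hc hd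

theorem replaceOn (hA : IsRearrangement T A X) (hB : IsRearrangement T B Y)
    (hXY : Disjoint X Y) : IsRearrangement T (replaceOn A B Y) (X ∪ Y) :=
  (hA.mono Set.subset_union_left).trans
    ((hA.replaceOn_left hB hXY).mono Set.subset_union_right)

theorem neighborSet_replaceOn (hA : IsRearrangement T A X) (hB : IsRearrangement T B Y)
    (hXY : Disjoint X Y) {u : V} (hu : u ∈ Y) :
    (FWalk.replaceOn A B Y).neighborSet u = B.neighborSet u := by
  have huX : u ∉ X := Set.disjoint_right.1 hXY hu
  ext b
  by_cases hb : b ∈ Y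
  · simp [FWalk.replaceOn, hu, hb]
  · have h := (hA.adj_iff u b (by tauto)).trans (hB.adj_iff u b (by tauto)).symm
    simp [FWalk.replaceOn, hb, h]

open scoped Classical in
theorem degree_replaceOn_of_mem_left [Fintype V] (hA : IsRearrangement T A X)
    (hB : IsRearrangement T B Y) (hXY : Disjoint X Y) {u : V} (hu : u ∈ X) :
    (FWalk.replaceOn A B Y).degree u = A.degree u :=
  (hA.replaceOn_left hB hXY).degree_eq (Set.disjoint_left.1 hXY hu)

open scoped Classical in
theorem degree_replaceOn_of_mem_right [Fintype V] (hA : IsRearrangement T A X)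
    (hB : IsRearrangement T B Y) (hXY : Disjoint X Y) {u : V} (hu : u ∈ Y) :
    (FWalk.replaceOn A B Y).degree u = B.degree u := by
  simp only [← card_neighborSet_eq_degree, hA.neighborSet_replaceOn hB hXY hu]

end IsRearrangement

section Degree

variable (G : SimpleGraph V) (s t : V) {u : V} [Fintype (G.neighborSet u)]

theorem degree_sup_edge_of_ne {_ : Fintype ((G ⊔ edge s t).neighborSet u)} (hs : u ≠ s)
    (ht : u ≠ t) : (G ⊔ edge s t).degree u = G.degree u := by
  have h : (G ⊔ edge s t).neighborSet u = G.neighborSet u := by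
    ext b
    simp [edge_adj, hs, ht]
  simp only [← card_neighborSet_eq_degree, h]

open scoped Classical in
theorem degree_sup_edge_le {_ : Fintype ((G ⊔ edge s t).neighborSet u)} :
    (G ⊔ edge s t).degree u ≤ G.degree u + 1 := by
  have h : (G ⊔ edge s t).neighborFinset u ⊆
      insert (if u = s then t else s) (G.neighborFinset u) := by
    intro b
    simp only [mem_neighborFinset, sup_adj, edge_adj, Finset.mem_insert]
    grind
  exact (Finset.card_le_card h).trans (Finset.card_insert_le _ _)

variable {G} in
theorem degree_deleteEdges_lt {v : V} [Fintype ((G.deleteEdges {s(u, v)}).neighborSet u)]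
    (h : G.Adj u v) : (G.deleteEdges {s(u, v)}).degree u < G.degree u := by
  refine Finset.card_lt_card ((Finset.ssubset_iff_of_subset fun b => ?_).2 ⟨v, ?_, ?_⟩)
  · simp +contextual
  · simpa using h
  · simp

end Degree

open scoped Classical in
theorem IsRearrangement.exists_exchange [Fintype V] {H M T C : SimpleGraph V} {W K : Set V}
    {F : V → ℕ} {x y z z' : V} (h : IsRearrangement T C W) (hWK : W ⊆ K) (hC : C ∈ Set.Icc M H)
    (hF : ∀ u ∈ W, C.degree u ≤ F u) (hx : x ∈ W) (hy : y ∈ W) (hFx : C.degree x < F x)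
    (hFy : C.degree y < F y) (hxy : H.Adj x y) (hz : z ∉ W) (hzz' : T.Adj z z')
    (hM : ¬M.Adj z z') (hxz : ReachableIn (T.deleteEdges {s(z, z')}) K x z)
    (hyz : ReachableIn (T.deleteEdges {s(z, z')}) K z' y) :
    ∃ T' ∈ Set.Icc M H, IsRearrangement T T' K ∧ T'.degree z < T.degree z ∧
      ∀ u, T'.degree u ≤ max (F u) (T.degree u) := by
  have hzx : z ≠ x := fun h => hz (h ▸ hx)
  have hzy : z ≠ y := fun h => hz (h ▸ hy)
  have hdel := (h.deleteEdges hz (z' := z')).mono hWK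
  have hswap : IsRearrangement C (C.deleteEdges {s(z, z')} ⊔ edge x y) K :=
    isRearrangement_deleteEdges_sup_edge (hxz.of_forall_adj hdel.reachableIn)
      (hyz.of_forall_adj hdel.reachableIn)
  refine ⟨C.deleteEdges {s(z, z')} ⊔ edge x y, ⟨fun a b hab => ?_, sup_le ?_ ?_⟩,
    (h.mono hWK).trans hswap, ?_, fun u => ?_⟩
  · refine .inl (deleteEdges_adj.2 ⟨hC.1 hab, fun he => hM ?_⟩)
    exact (adj_congr_of_sym2 M (Set.mem_singleton_iff.1 he)).1 hab
  · exact (deleteEdges_le _).trans hC.2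
  · exact (edge_le_iff _).2 (.inr hxy)
  · rw [degree_sup_edge_of_ne _ _ _ hzx hzy, ← h.degree_eq hz]
    exact degree_deleteEdges_lt ((h.adj_iff z z' fun hzW => hz hzW.1).2 hzz')
  · have hdel_le : (C.deleteEdges {s(z, z')}).degree u ≤ C.degree u :=
      degree_le_of_le (deleteEdges_le _)
    by_cases hu : u = x ∨ u = y
    · have hlt : C.degree u < F u := by rcases hu with rfl | rfl <;> assumption
      exact le_max_of_le_left ((degree_sup_edge_le _ x y).trans (by omega))
    · rw [degree_sup_edge_of_ne _ _ _ (not_or.1 hu).1 (not_or.1 hu).2]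
      by_cases huW : u ∈ W
      · exact le_max_of_le_left (hdel_le.trans (hF u huW))
      · exact le_max_of_le_right (hdel_le.trans (h.degree_eq huW).le)

theorem exists_adj_reachableIn_deleteEdges {M T : SimpleGraph V}
    (hM : ∀ v, (M.neighborSet v).Subsingleton) {K : Set V} {x y z : V} {p : T.Walk x y}
    (hp : p.IsPath) (hK : ∀ v ∈ p.support, v ∈ K) (hz : z ∈ p.support) (hzx : z ≠ x)
    (hzy : z ≠ y) :
    ∃ a, T.Adj z a ∧ ¬M.Adj z a ∧
      (ReachableIn (T.deleteEdges {s(z, a)}) K x z ∧ ReachableIn (T.deleteEdges {s(z, a)}) K a y ∨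
        ReachableIn (T.deleteEdges {s(z, a)}) K y z ∧
          ReachableIn (T.deleteEdges {s(z, a)}) K a x) := by
  obtain ⟨q, r, rfl⟩ := Walk.mem_support_iff_exists_append.1 hz
  -- `M` has at most one edge at `z`, so it misses one of the two edges of `p` at `z`.
  cases r with
  | nil => exact absurd rfl hzy
  | @cons _ a _ ha r =>
    by_cases hMa : M.Adj z a
    · cases hq : q.reverse with
      | nil => exact absurd rfl hzx
      | @cons _ b _ hb q' =>
        have hrev : (q.append (.cons ha r)).reverse =
            (Walk.cons ha r).reverse.append (.cons hb q') := by
          rw [Walk.reverse_append, hq]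
        have hp' := hrev ▸ hp.reverse
        have hK' : ∀ v ∈ ((Walk.cons ha r).reverse.append (.cons hb q')).support, v ∈ K := by
          rw [← hrev]
          simpa only [Walk.support_reverse, List.mem_reverse] using hK
        have hab : a ≠ b := by
          have hnodup := hp'.support_nodup
          rw [Walk.support_append, List.nodup_append] at hnodup
          exact hnodup.2.2 a (by simp) b (by simp)
        exact ⟨b, hb, fun hMb => hab (hM z hMa hMb),
          .inr (reachableIn_deleteEdges_of_isTrail hp'.isTrail hK')⟩
    · exact ⟨a, ha, hMa, .inl (reachableIn_deleteEdges_of_isTrail hp.isTrail hK)⟩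

/-- The vertex set of the component of `T ∖ D` that contains `v`; it is empty if `v ∈ D`. -/
def branch (T : SimpleGraph V) (D : Finset V) (v : V) : Set V :=
  {u | ReachableIn T (D : Set V)ᶜ v u}

section Branch

variable {T : SimpleGraph V} {D D' : Finset V} {u v : V}

theorem self_mem_branch (hv : v ∉ D) : v ∈ branch T D v :=
  ReachableIn.refl (by simpa using hv)

theorem notMem_of_mem_branch (h : u ∈ branch T D v) : u ∉ D := by
  simpa using ReachableIn.right_mem h

theorem branch_subset (h : u ∈ branch T D v) (hD : D ⊆ D') : branch T D' u ⊆ branch T D v :=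
  fun _ hw => ReachableIn.trans h (ReachableIn.mono le_rfl (by simpa using hD) hw)

theorem disjoint_branch (h : u ∉ branch T D v) : Disjoint (branch T D v) (branch T D u) :=
  Set.disjoint_left.2 fun _ hv hu => h (ReachableIn.trans hv (ReachableIn.symm hu))

end Branch

section Barrier

variable [Fintype V] {H M T : SimpleGraph V} {F : V → ℕ} {D : Finset V}

open scoped Classical in
/-- A barrier for decreasing the degrees of `T` to the bounds `F`: the vertices of `D` reach their
bounds, no vertex outside `D` exceeds its bound, and each vertex outside `D` can be brought below
its bound by rearranging `T`, between `M` and `H`, inside its component of `T ∖ D`. -/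
structure IsBarrier (H M T : SimpleGraph V) (F : V → ℕ) (D : Finset V) : Prop where
  le_degree : ∀ v ∈ D, F v ≤ T.degree v
  degree_le : ∀ v ∉ D, T.degree v ≤ F v
  exists_degree_lt : ∀ v ∉ D, ∃ T' ∈ Set.Icc M H, IsRearrangement T T' (branch T D v) ∧
    (∀ u ∈ branch T D v, T'.degree u ≤ F u) ∧ T'.degree v < F v

open scoped Classical in
theorem isBarrier_filter_le_degree (hT : T ∈ Set.Icc M H) (F : V → ℕ) :
    IsBarrier H M T F {v | F v ≤ T.degree v} := by
  have hlt : ∀ v ∉ ({v | F v ≤ T.degree v} : Finset V), T.degree v < F v := by simp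
  exact ⟨by simp, fun v hv => (hlt v hv).le, fun v hv =>
    ⟨T, hT, .refl _ _, fun u hu => (hlt u (notMem_of_mem_branch hu)).le, hlt v hv⟩⟩

namespace IsBarrier

open scoped Classical in
theorem exists_exchange (hD : IsBarrier H M T F D) (hM : ∀ v, (M.neighborSet v).Subsingleton)
    {K : Set V} {x y z : V} (hx : x ∉ D) (hy : y ∉ D) (hxy : H.Adj x y) (hyx : y ∉ branch T D x)
    {p : T.Walk x y} (hp : p.IsPath) (hz : z ∈ p.support) (hzD : z ∈ D)
    (hpK : ∀ v ∈ p.support, v ∈ K) (hXK : branch T D x ⊆ K) (hYK : branch T D y ⊆ K) :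
    ∃ T' ∈ Set.Icc M H, IsRearrangement T T' K ∧ T'.degree z < T.degree z ∧
      ∀ u, T'.degree u ≤ max (F u) (T.degree u) := by
  obtain ⟨A, hAIcc, hA, hAF, hAx⟩ := hD.exists_degree_lt x hx
  obtain ⟨B, hBIcc, hB, hBF, hBy⟩ := hD.exists_degree_lt y hy
  have hXY := disjoint_branch hyx
  have hxX : x ∈ branch T D x := self_mem_branch hx
  have hyY : y ∈ branch T D y := self_mem_branch hy
  have hC := hA.replaceOn hB hXY
  have hWK := Set.union_subset hXK hYK
  have hzW : z ∉ branch T D x ∪ branch T D y := fun h =>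
    h.elim (notMem_of_mem_branch · hzD) (notMem_of_mem_branch · hzD)
  have hCIcc := replaceOn_mem_Icc hAIcc hBIcc (branch T D y)
  have hCF : ∀ u ∈ branch T D x ∪ branch T D y, (replaceOn A B (branch T D y)).degree u ≤ F u := by
    rintro u (hu | hu)
    · exact (hA.degree_replaceOn_of_mem_left hB hXY hu).trans_le (hAF u hu)
    · exact (hA.degree_replaceOn_of_mem_right hB hXY hu).trans_le (hBF u hu)
  have hCx := (hA.degree_replaceOn_of_mem_left hB hXY hxX).trans_lt hAx
  have hCy := (hA.degree_replaceOn_of_mem_right hB hXY hyY).trans_lt hBy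
  obtain ⟨a, hza, hMa, ⟨h₁, h₂⟩ | ⟨h₁, h₂⟩⟩ := exists_adj_reachableIn_deleteEdges hM hp hpK hz
    (fun h => hx (h ▸ hzD)) (fun h => hy (h ▸ hzD))
  · exact hC.exists_exchange hWK hCIcc hCF (.inl hxX) (.inr hyY) hCx hCy hxy hzW hza hMa h₁ h₂
  · exact hC.exists_exchange hWK hCIcc hCF (.inr hyY) (.inl hxX) hCy hCx hxy.symm hzW hza hMa h₁ h₂

end IsBarrier

open scoped Classical in
/-- The total amount by which the degrees of `T` exceed the bounds `F`, with truncated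
subtraction. -/
noncomputable def excess (T : SimpleGraph V) (F : V → ℕ) : ℕ :=
  ∑ v, (T.degree v - F v)

open scoped Classical in
theorem excess_mono {T T' : SimpleGraph V} (h : T ≤ T') (F : V → ℕ) : excess T F ≤ excess T' F :=
  Finset.sum_le_sum fun _ _ => Nat.sub_le_sub_right (degree_le_of_le h) _

open scoped Classical in
theorem excess_lt_excess {T T' : SimpleGraph V} {F : V → ℕ} {z : V}
    (h : ∀ u, T'.degree u ≤ max (F u) (T.degree u)) (hF : F z < T.degree z)
    (hz : T'.degree z < T.degree z) : excess T' F < excess T F := by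
  refine Finset.sum_lt_sum (fun u _ => ?_) ⟨z, Finset.mem_univ z, by omega⟩
  have := h u
  omega

namespace IsBarrier

open scoped Classical in
theorem filter_notMem_support (hD : IsBarrier H M T F D) {x y : V} {p : T.Walk x y}
    (hle : ∀ z ∈ p.support, T.degree z ≤ F z)
    (hex : ∀ z ∈ p.support, z ∈ D → ∃ T' ∈ Set.Icc M H,
      IsRearrangement T T' (branch T {v ∈ D | v ∉ p.support} z) ∧ T'.degree z < T.degree z ∧
        ∀ u, T'.degree u ≤ max (F u) (T.degree u)) :
    IsBarrier H M T F {v ∈ D | v ∉ p.support} := by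
  set D' := {v ∈ D | v ∉ p.support} with hD'
  have hD'D : D' ⊆ D := Finset.filter_subset _ _
  have hmem : ∀ v ∉ D', v ∈ D → v ∈ p.support := by simp +contextual [hD']
  have hdeg : ∀ v ∉ D', T.degree v ≤ F v := fun v hv =>
    if hvD : v ∈ D then hle v (hmem v hv hvD) else hD.degree_le v hvD
  refine ⟨fun v hv => hD.le_degree v (hD'D hv), hdeg, fun v hv => ?_⟩
  by_cases hvD : v ∈ D
  · obtain ⟨T', hT', hrearr, hlt, hmax⟩ := hex v (hmem v hv hvD) hvD
    exact ⟨T', hT', hrearr, fun u hu => (hmax u).trans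
      (max_le le_rfl (hdeg u (notMem_of_mem_branch hu))), hlt.trans_le (hdeg v hv)⟩
  · obtain ⟨T', hT', hrearr, hF, hlt⟩ := hD.exists_degree_lt v hvD
    refine ⟨T', hT', hrearr.mono (branch_subset (self_mem_branch hv) hD'D), fun u hu => ?_, hlt⟩
    by_cases hu' : u ∈ branch T D v
    · exact hF u hu'
    · exact (hrearr.degree_eq hu').trans_le (hdeg u (notMem_of_mem_branch hu))

open scoped Classical in
theorem mem_branch_of_adj (hD : IsBarrier H M T F D)
    (hDmin : ∀ D', IsBarrier H M T F D' → D.card ≤ D'.card)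
    (hM : ∀ v, (M.neighborSet v).Subsingleton) (hT : T.Connected)
    (hmin : ∀ T' ∈ Set.Icc M H, T'.Connected → excess T F ≤ excess T' F)
    {x y : V} (hx : x ∉ D) (hy : y ∉ D) (hxy : H.Adj x y) : y ∈ branch T D x := by
  by_contra hyx
  obtain ⟨p, hp⟩ := hT.exists_isPath x y
  obtain ⟨z, hz, hzD⟩ : ∃ z ∈ p.support, z ∈ D := by
    by_contra! hcon
    exact hyx ⟨p, by simpa using hcon⟩
  set D' := {v ∈ D | v ∉ p.support}
  have hD'D : D' ⊆ D := Finset.filter_subset _ _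
  have hsupp : ∀ v ∈ p.support, v ∈ ((D' : Set V)ᶜ) := by simp +contextual [D']
  have hpath : ∀ v ∈ p.support, v ∈ branch T D' x := fun v hv =>
    ⟨p.takeUntil v hv, fun u hu => hsupp u (p.support_takeUntil_subset_support hv hu)⟩
  have hex : ∀ z ∈ p.support, z ∈ D → ∃ T' ∈ Set.Icc M H,
      IsRearrangement T T' (branch T D' x) ∧ T'.degree z < T.degree z ∧
        ∀ u, T'.degree u ≤ max (F u) (T.degree u) := fun z hz hzD =>
    hD.exists_exchange hM hx hy hxy hyx hp hz hzD hpath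
      (branch_subset (hpath x p.start_mem_support) hD'D)
      (branch_subset (hpath y p.end_mem_support) hD'D)
  have hle : ∀ z ∈ p.support, T.degree z ≤ F z := by
    refine fun z hz => if hzD : z ∈ D then ?_ else hD.degree_le z hzD
    by_contra! hlt
    obtain ⟨T', hT', hrearr, hz', hmax⟩ := hex z hz hzD
    exact (hmin T' hT' (hrearr.connected hT)).not_gt (excess_lt_excess hmax hlt hz')
  have hD' : IsBarrier H M T F D' := hD.filter_notMem_support hle fun z hz hzD =>
    let ⟨T', hT', hrearr, h⟩ := hex z hz hzD
    ⟨T', hT', hrearr.mono (branch_subset (ReachableIn.symm (hpath z hz)) subset_rfl), h⟩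
  exact (hDmin D' hD').not_gt (Finset.card_lt_card (Finset.filter_ssubset.2 ⟨z, hzD, by simpa⟩))

end IsBarrier

end Barrier

section Counting

theorem card_connectedComponent_le_of_forall_reachable {W : Type*} [Finite V] {G : SimpleGraph V}
    {G' : SimpleGraph W} (φ : V → W) (hadj : ∀ a b, G.Adj a b → G'.Reachable (φ a) (φ b))
    (hsurj : ∀ w, ∃ v, G'.Reachable (φ v) w) :
    Nat.card G'.ConnectedComponent ≤ Nat.card G.ConnectedComponent := by
  have hreach : ∀ a b, G.Reachable a b → G'.Reachable (φ a) (φ b) := by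
    rintro a b ⟨p⟩
    induction p with
    | nil => exact .refl _
    | cons h _ ih => exact (hadj _ _ h).trans ih
  refine Nat.card_le_card_of_surjective (Quot.map φ hreach) fun c => ?_
  induction c using ConnectedComponent.ind with
  | h w =>
    obtain ⟨v, hv⟩ := hsurj w
    exact ⟨G.connectedComponentMk v, ConnectedComponent.sound hv⟩

theorem card_le_card_edgeSet_add_card_connectedComponent [Finite V] (G : SimpleGraph V) :
    Nat.card V ≤ Nat.card G.edgeSet + Nat.card G.ConnectedComponent := by
  rcases isEmpty_or_nonempty V with hV | ⟨⟨v₀⟩⟩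
  · simp
  let c₀ := G.connectedComponentMk v₀
  let star : Set (Sym2 V) := (fun c : G.ConnectedComponent => s(v₀, c.out)) '' {c₀}ᶜ
  have hconn : (G ⊔ fromEdgeSet star).Connected := by
    refine connected_iff_exists_forall_reachable _ |>.2 ⟨v₀, fun v => ?_⟩
    let c := G.connectedComponentMk v
    have hout : G.Reachable c.out v := ConnectedComponent.exact (Quot.out_eq c)
    by_cases hc : c = c₀
    · exact (ConnectedComponent.exact hc).symm.mono le_sup_left
    · have hne : v₀ ≠ c.out := fun h => hc (ConnectedComponent.sound (h ▸ hout.symm))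
      have hadj : (G ⊔ fromEdgeSet star).Adj v₀ c.out :=
        .inr ((fromEdgeSet_adj _).2 ⟨⟨c, hc, rfl⟩, hne⟩)
      exact hadj.reachable.trans (hout.mono le_sup_left)
  have hstar : star.ncard + 1 ≤ Nat.card G.ConnectedComponent := by
    rw [← Set.ncard_add_ncard_compl {c₀}, Set.ncard_singleton, add_comm]
    exact Nat.add_le_add_left (Set.ncard_image_le (Set.toFinite _)) 1
  have hedges : Nat.card (G ⊔ fromEdgeSet star).edgeSet ≤ Nat.card G.edgeSet + star.ncard := by
    rw [edgeSet_sup, edgeSet_fromEdgeSet]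
    exact (Set.ncard_union_le _ _).trans
      (Nat.add_le_add_left (Set.ncard_le_ncard Set.sdiff_subset (Set.toFinite _)) _)
  have := hconn.card_vert_le_card_edgeSet_add_one
  omega

theorem card_edgeSet_add_one_le_of_isAcyclic [Finite V] [Nonempty V] {G : SimpleGraph V}
    (h : G.IsAcyclic) : Nat.card G.edgeSet + 1 ≤ Nat.card V := by
  classical
  cases nonempty_fintype V
  obtain ⟨T, hGT, -, hT⟩ := Connected.exists_isTree_le_of_le_of_isAcyclic
    (G := (⊤ : SimpleGraph V)) connected_top le_top h
  rw [Nat.card_eq_fintype_card, Nat.card_eq_fintype_card, ← hT.card_edgeFinset, card_edgeSet]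
  gcongr

theorem sum_degree_eq_sum_card_filter_mem [Fintype V] [DecidableEq V] (G : SimpleGraph V)
    [DecidableRel G.Adj] (D : Finset V) :
    ∑ v ∈ D, G.degree v = ∑ e ∈ G.edgeFinset, {v ∈ D | v ∈ e}.card := by
  simp only [← card_incidenceFinset_eq_degree, incidenceFinset_eq_filter]
  exact Finset.sum_card_bipartiteAbove_eq_sum_card_bipartiteBelow (fun v e => v ∈ e)

theorem card_filter_mem_mk [DecidableEq V] (D : Finset V) {a b : V} (hab : a ≠ b) :
    {v ∈ D | v ∈ s(a, b)}.card = (if a ∈ D then 1 else 0) + if b ∈ D then 1 else 0 := by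
  simp only [Sym2.mem_iff, Finset.filter_or, Finset.filter_eq']
  rw [Finset.card_union_of_disjoint] <;> split_ifs <;> simp [hab]

variable [Fintype V]

theorem card_edgeSet_induce [DecidableEq V] (G : SimpleGraph V) [DecidableRel G.Adj]
    (D : Finset V) : Nat.card (G.induce (D : Set V)).edgeSet =
      {e ∈ G.edgeFinset | e ∈ D.sym2}.card := by
  have h := congrArg Finset.card (map_edgeFinset_induce (s := (D : Set V)) (G := G))
  rw [Finset.card_map, Finset.toFinset_coe, ← Finset.filter_mem_eq_inter] at h
  rw [← h, ← Set.ncard_coe_finset, coe_edgeFinset, Nat.card_coe_set_eq]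

theorem sum_degree_add_card_edgeSet_induce_compl (G : SimpleGraph V)
    [DecidableRel G.Adj] (D : Finset V) :
    ∑ v ∈ D, G.degree v + Nat.card (G.induce (D : Set V)ᶜ).edgeSet =
      Nat.card (G.induce (D : Set V)).edgeSet + Nat.card G.edgeSet := by
  classical
  rw [← Finset.coe_compl, sum_degree_eq_sum_card_filter_mem, card_edgeSet_induce,
    card_edgeSet_induce, Nat.card_eq_fintype_card, ← edgeFinset_card, Finset.card_filter,
    Finset.card_filter, Finset.card_eq_sum_ones G.edgeFinset, ← Finset.sum_add_distrib,
    ← Finset.sum_add_distrib]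
  refine Finset.sum_congr rfl fun e he => ?_
  induction e with | _ a b =>
  have hab : a ≠ b := (mem_edgeFinset.1 he).ne
  simp only [card_filter_mem_mk D hab, Finset.mk_mem_sym2_iff, Finset.mem_compl]
  by_cases ha : a ∈ D <;> by_cases hb : b ∈ D <;> simp [ha, hb]

theorem sum_degree_add_two_le_of_isTree {T : SimpleGraph V} [DecidableRel T.Adj]
    (hT : T.IsTree) {D : Finset V} (hD : D.Nonempty) :
    ∑ v ∈ D, T.degree v + 2 ≤
      Nat.card (T.induce (D : Set V)ᶜ).ConnectedComponent + 2 * D.card := by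
  have hsum := sum_degree_add_card_edgeSet_induce_compl T D
  have : Nonempty (D : Set V) := hD.to_subtype
  have hin := card_edgeSet_add_one_le_of_isAcyclic (hT.isAcyclic.induce (D : Set V))
  have hout := card_le_card_edgeSet_add_card_connectedComponent (T.induce (D : Set V)ᶜ)
  have hedges := hT.card_edgeFinset
  have hcard := Set.ncard_add_ncard_compl (D : Set V)
  rw [edgeFinset_card, ← Nat.card_eq_fintype_card, ← Nat.card_eq_fintype_card] at hedges
  rw [Set.ncard_coe_finset, ← Nat.card_coe_set_eq] at hcard
  have hcardD : Nat.card (D : Set V) = D.card := by simp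
  omega

end Counting

/-- The hypothesis of the theorem for a simple graph: `ω(H ∖ D) ≤ ∑_{v ∈ D} (f v - 1) + 1` for every
set `D` of vertices. The sum is taken in `ℤ`, so that subtraction is not truncated. -/
def ComponentBound (H : SimpleGraph V) (f : V → ℕ) : Prop :=
  ∀ D : Finset V, (Nat.card (H.induce (D : Set V)ᶜ).ConnectedComponent : ℤ) ≤
    ∑ v ∈ D, ((f v : ℤ) - 1) + 1

theorem ComponentBound.preconnected [Finite V] {H : SimpleGraph V} {f : V → ℕ}
    (hH : ComponentBound H f) : H.Preconnected := by
  have hcard : Nat.card (H.induce ((∅ : Finset V) : Set V)ᶜ).ConnectedComponent ≤ 1 := by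
    simpa using hH ∅
  have := Finite.card_le_one_iff_subsingleton.1 hcard
  intro a b
  have hab : (H.induce ((∅ : Finset V) : Set V)ᶜ).Reachable ⟨a, by simp⟩ ⟨b, by simp⟩ :=
    ConnectedComponent.exact (Subsingleton.elim _ _)
  exact hab.map (Embedding.induce _).toHom

theorem isAcyclic_of_neighborSet_subsingleton {M : SimpleGraph V}
    (hM : ∀ v, (M.neighborSet v).Subsingleton) : M.IsAcyclic := fun v c hc =>
  hc.snd_ne_penultimate <| hM v (c.adj_snd hc.not_nil) (c.adj_penultimate hc.not_nil).symm

open scoped Classical in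
theorem ComponentBound.exists_isTree [Fintype V] [Nonempty V] {H M : SimpleGraph V} {f : V → ℕ}
    (hH : ComponentBound H f) (hMH : M ≤ H) (hM : ∀ v, (M.neighborSet v).Subsingleton) :
    ∃ T ∈ Set.Icc M H, T.IsTree ∧ ∀ v, T.degree v ≤ f v + 1 := by
  obtain ⟨T₀, ⟨⟨hMT₀, hT₀H⟩, hT₀⟩, hmin⟩ := Set.exists_min_image
    {T | T ∈ Set.Icc M H ∧ T.Connected} (excess · (f + 1)) (Set.toFinite _)
    ⟨H, ⟨hMH, le_rfl⟩, ⟨hH.preconnected⟩⟩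
  obtain ⟨T, hMT, hTT₀, hT⟩ := hT₀.exists_isTree_le_of_le_of_isAcyclic hMT₀
    (isAcyclic_of_neighborSet_subsingleton hM)
  have hTIcc : T ∈ Set.Icc M H := ⟨hMT, hTT₀.trans hT₀H⟩
  refine ⟨T, hTIcc, hT, ?_⟩
  obtain ⟨D, hD, hDmin⟩ := Set.exists_min_image {D | IsBarrier H M T (f + 1) D} Finset.card
    (Set.toFinite _) ⟨_, isBarrier_filter_le_degree hTIcc _⟩
  refine fun v => hD.degree_le v fun hvD => ?_
  have hcomp : Nat.card (T.induce (D : Set V)ᶜ).ConnectedComponent ≤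
      Nat.card (H.induce (D : Set V)ᶜ).ConnectedComponent :=
    card_connectedComponent_le_of_forall_reachable id
      (fun a b hab => (hD.mem_branch_of_adj hDmin hM hT.connected
        (fun T' hT' hc => (excess_mono hTT₀ _).trans (hmin T' ⟨hT', hc⟩))
        a.2 b.2 hab).induce_reachable)
      fun w => ⟨w, .refl _⟩
  have hupper := hH D
  have hlower := sum_degree_add_two_le_of_isTree hT ⟨v, hvD⟩
  have hsum := Finset.sum_le_sum hD.le_degree
  simp only [Pi.add_apply, Pi.one_apply, Finset.sum_add_distrib, Finset.sum_const, smul_eq_mul,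
    mul_one] at hsum
  simp only [Finset.sum_sub_distrib, Finset.sum_const, nsmul_eq_mul, mul_one] at hupper
  rw [← Nat.cast_sum] at hupper
  omega

section Euler

/-- The degree of `v` in the loopless multigraph with edge multiset `E`. A loop `s(v, v)` would
count only once. -/
def degreeIn [DecidableEq V] (E : Multiset (Sym2 V)) (v : V) : ℕ :=
  E.countP (v ∈ ·)

theorem degreeIn_add [DecidableEq V] (E F : Multiset (Sym2 V)) (v : V) :
    degreeIn (E + F) v = degreeIn E v + degreeIn F v :=
  Multiset.countP_add _ _ _

theorem degreeIn_edgeFinset [Fintype V] [DecidableEq V] (G : SimpleGraph V) [DecidableRel G.Adj]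
    (v : V) : degreeIn G.edgeFinset.val v = G.degree v := by
  rw [degreeIn, Multiset.countP_eq_card_filter, ← Finset.filter_val, Finset.card_val,
    ← incidenceFinset_eq_filter, card_incidenceFinset_eq_degree]

theorem exists_mem_sub_of_degreeIn_lt [DecidableEq V] {E F : Multiset (Sym2 V)} {v : V}
    (h : degreeIn F v < degreeIn E v) : ∃ e ∈ E - F, v ∈ e := by
  by_contra! hno
  have hEF : degreeIn (E - F) v = 0 := Multiset.countP_eq_zero.2 hno
  have hle : degreeIn E v ≤ degreeIn (E - F + F) v := Multiset.countP_le_of_le _ le_tsub_add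
  rw [degreeIn_add] at hle
  omega

variable {H : SimpleGraph V} {E : Multiset (Sym2 V)}

theorem degreeIn_edges_add [DecidableEq V] {x y : V} (p : H.Walk x y) (v : V) :
    degreeIn p.edges v + (if v = y then 1 else 0) =
      2 * p.support.tail.count v + (if v = x then 1 else 0) := by
  rw [degreeIn, Multiset.coe_countP]
  induction p with
  | nil => simp
  | @cons a b c h p ih =>
    have hsupport : p.support.count v = p.support.tail.count v + (if v = b then 1 else 0) := by
      rw [← p.cons_tail_support, List.count_cons]
      simp only [beq_iff_eq, eq_comm (a := b), List.tail_cons]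
    have hedge : (if v ∈ s(a, b) then 1 else 0) =
        (if v = a then 1 else 0) + (if v = b then 1 else 0) := by
      have := h.ne
      by_cases ha : v = a <;> by_cases hb : v = b <;> simp_all
    simp only [Walk.edges_cons, List.countP_cons, Walk.support_cons, List.tail_cons,
      decide_eq_true_eq]
    omega

theorem exists_cons_edges_le [DecidableEq V] (hE : ∀ e ∈ E, e ∈ H.edgeSet) {x y : V}
    {p : H.Walk x y} (hp : (p.edges : Multiset (Sym2 V)) ≤ E) {e : Sym2 V} (he : e ∈ E - p.edges)
    (hx : x ∈ e) : ∃ (b : V) (h : H.Adj b x), ((Walk.cons h p).edges : Multiset (Sym2 V)) ≤ E := by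
  obtain ⟨b, rfl⟩ := Sym2.mem_iff_exists.1 hx
  have hadj : H.Adj x b := hE _ (Multiset.mem_of_le tsub_le_self he)
  refine ⟨b, hadj.symm, ?_⟩
  rw [Walk.edges_cons, ← Multiset.cons_coe, ← Multiset.singleton_add, Sym2.eq_swap]
  exact (le_tsub_iff_right hp).1 (Multiset.singleton_le.2 he)

theorem exists_walk_forall_length_le [Nonempty V] (H : SimpleGraph V) (E : Multiset (Sym2 V)) :
    ∃ (x y : V) (p : H.Walk x y), (p.edges : Multiset (Sym2 V)) ≤ E ∧
      ∀ {x' y' : V} (q : H.Walk x' y'), (q.edges : Multiset (Sym2 V)) ≤ E →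
        q.length ≤ p.length := by
  let lengths : Set ℕ :=
    {n | ∃ (x y : V) (p : H.Walk x y), (p.edges : Multiset (Sym2 V)) ≤ E ∧ p.length = n}
  have hne : lengths.Nonempty := ⟨0, Classical.arbitrary V, _, .nil, by simp, rfl⟩
  have hbdd : BddAbove lengths := by
    refine ⟨E.card, ?_⟩
    rintro _ ⟨x, y, p, hp, rfl⟩
    simpa using Multiset.card_le_card hp
  obtain ⟨x, y, p, hp, hlength⟩ := Nat.sSup_mem hne hbdd
  exact ⟨x, y, p, hp, fun q hq => hlength ▸ le_csSup hbdd ⟨_, _, q, hq, rfl⟩⟩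

theorem exists_closed_walk_forall_notMem_sub [DecidableEq V] [Nonempty V]
    (hE : ∀ e ∈ E, e ∈ H.edgeSet) (heven : ∀ v, Even (degreeIn E v)) :
    ∃ (x : V) (p : H.Walk x x), (p.edges : Multiset (Sym2 V)) ≤ E ∧
      ∀ a ∈ p.support, ∀ e ∈ E - p.edges, a ∉ e := by
  obtain ⟨x, y, p, hp, hmax⟩ := exists_walk_forall_length_le H E
  have hstart : ∀ {x' y' : V} {q : H.Walk x' y'}, (q.edges : Multiset (Sym2 V)) ≤ E →
      q.length = p.length → ∀ e ∈ E - q.edges, x' ∉ e := by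
    intro x' y' q hq hlength e he hx
    obtain ⟨b, h, hle⟩ := exists_cons_edges_le hE hq he hx
    have := hmax _ hle
    rw [Walk.length_cons] at this
    omega
  obtain rfl : x = y := by
    by_contra hxy
    have hodd := degreeIn_edges_add p x
    rw [if_neg hxy, if_pos rfl] at hodd
    obtain ⟨k, hk⟩ := heven x
    have hle : degreeIn p.edges x ≤ degreeIn E x := Multiset.countP_le_of_le _ hp
    obtain ⟨e, he, hx⟩ := exists_mem_sub_of_degreeIn_lt (E := E) (F := p.edges) (v := x) (by omega)
    exact hstart hp rfl e he hx
  refine ⟨x, p, hp, fun a ha e he => ?_⟩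
  have hperm := (p.rotate_edges a ha).perm
  have hedges : ((p.rotate a ha).edges : Multiset (Sym2 V)) = p.edges := Multiset.coe_eq_coe.2 hperm
  refine hstart (hedges ▸ hp) ?_ e (hedges ▸ he)
  rw [← Walk.length_edges, ← Walk.length_edges, hperm.length_eq]

theorem exists_closed_walk_edges_eq [DecidableEq V] (hE : ∀ e ∈ E, e ∈ H.edgeSet)
    (heven : ∀ v, Even (degreeIn E v)) (hconn : (fromEdgeSet {e | e ∈ E}).Connected) :
    ∃ (x : V) (p : H.Walk x x), (p.edges : Multiset (Sym2 V)) = E ∧ ∀ v, v ∈ p.support := by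
  have := hconn.nonempty
  obtain ⟨x, p, hp, hsaturated⟩ := exists_closed_walk_forall_notMem_sub hE heven
  have hclosed : ∀ {a b : V}, (fromEdgeSet {e | e ∈ E}).Walk a b → a ∈ p.support →
      b ∈ p.support := by
    intro a b q ha
    induction q with
    | nil => exact ha
    | @cons a c _ hac _ ih =>
      have hedge : s(a, c) ∈ p.edges := by
        by_contra hp
        refine hsaturated a ha s(a, c) ?_ (Sym2.mem_mk_left a c)
        rw [Multiset.mem_sub, Multiset.coe_count, List.count_eq_zero_of_not_mem hp]
        exact Multiset.count_pos.2 ((fromEdgeSet_adj _).1 hac).1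
      exact ih (p.snd_mem_support_of_mem_edges hedge)
  have hspan : ∀ v, v ∈ p.support := fun v =>
    (hconn.preconnected x v).elim fun q => hclosed q p.start_mem_support
  refine ⟨x, p, hp.antisymm (tsub_eq_zero_iff_le.1 (Multiset.eq_zero_of_forall_notMem ?_)), hspan⟩
  intro e he
  induction e with
  | _ a b => exact hsaturated a (hspan a) _ he (Sym2.mem_mk_left a b)

end Euler

section BlowUp

theorem not_isTutteViolator_of_card_connectedComponent_le [Finite V] {G : SimpleGraph V}
    {X : Set V} (heven : Even (Nat.card V))
    (hX : Nat.card ((⊤ : G.Subgraph).deleteVerts X).coe.ConnectedComponent ≤ X.ncard + 1) :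
    ¬G.IsTutteViolator X := by
  intro hviol
  let K := ((⊤ : G.Subgraph).deleteVerts X).coe
  have hle : K.oddComponents.ncard ≤ Nat.card K.ConnectedComponent := Set.ncard_le_card _
  have hodd : K.oddComponents.ncard = X.ncard + 1 := le_antisymm (hle.trans hX) hviol
  have hparity := odd_ncard_oddComponents (G := K)
  have hcard : Nat.card ((⊤ : G.Subgraph).deleteVerts X).verts + X.ncard = Nat.card V := by
    rw [Subgraph.deleteVerts_verts, Subgraph.verts_top, ← Set.compl_eq_univ_sdiff,
      Nat.card_coe_set_eq, add_comm, Set.ncard_add_ncard_compl]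
  rw [hodd] at hparity
  grind

theorem degreeIn_filter_map_add [DecidableEq V] {W : Type*} [Fintype W]
    (G : SimpleGraph W) [DecidableRel G.Adj] (π : W → V) (v : V) :
    degreeIn ((G.edgeFinset.val.map (Sym2.map π)).filter (¬·.IsDiag)) v +
        2 * (G.edgeFinset.val.map (Sym2.map π)).count s(v, v) =
      ∑ p with π p = v, G.degree p := by
  classical
  rw [sum_degree_eq_sum_card_filter_mem, degreeIn, Multiset.countP_filter, Multiset.countP_map,
    Multiset.count_map, ← Finset.filter_val, ← Finset.filter_val, Finset.card_val, Finset.card_val,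
    Finset.card_filter, Finset.card_filter, Finset.mul_sum, ← Finset.sum_add_distrib]
  refine Finset.sum_congr rfl fun e he => ?_
  induction e with | _ a b =>
  have hab : a ≠ b := (mem_edgeFinset.1 he).ne
  rw [card_filter_mem_mk _ hab]
  by_cases ha : π a = v <;> by_cases hb : π b = v <;> simp [ha, hb, eq_comm (a := v)]

/-- The graph obtained from `H` by replacing each vertex `v` by a clique of `h v` copies. A perfect
matching of it, projected to `V`, is a multigraph on the edges of `H` with degrees at most `h` and
congruent to `h` modulo `2`: an edge within a clique takes `2` from the degree of its vertex. -/
def blowUp (H : SimpleGraph V) (h : V → ℕ) : SimpleGraph (Σ v, Fin (h v)) where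
  Adj p q := H.Adj p.1 q.1 ∨ p.1 = q.1 ∧ p ≠ q
  symm := ⟨fun _ _ hpq => hpq.imp (·.symm) fun hpq => ⟨hpq.1.symm, hpq.2.symm⟩⟩
  loopless := ⟨fun _ hp => hp.elim (fun hp => hp.ne rfl) fun hp => hp.2 rfl⟩

variable [Fintype V] {H : SimpleGraph V} {h : V → ℕ}

theorem card_connectedComponent_deleteVerts_blowUp_le (X : Set (Σ v, Fin (h v)))
    [DecidablePred (· ∈ X)] :
    Nat.card ((⊤ : (blowUp H h).Subgraph).deleteVerts X).coe.ConnectedComponent ≤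
      Nat.card (H.induce
        (({v | ∀ i, ⟨v, i⟩ ∈ X} : Finset V) : Set V)ᶜ).ConnectedComponent := by
  have hcopy : ∀ v : ((({v | ∀ i, ⟨v, i⟩ ∈ X} : Finset V) : Set V)ᶜ : Set V),
      ∃ i, (⟨v, i⟩ : Σ v, Fin (h v)) ∉ X := fun v => by simpa using v.2
  choose copy hcopy using hcopy
  have hreach : ∀ p q (hp : p ∉ X) (hq : q ∉ X), H.Adj p.1 q.1 ∨ p.1 = q.1 →
      ((⊤ : (blowUp H h).Subgraph).deleteVerts X).coe.Reachable ⟨p, trivial, hp⟩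
        ⟨q, trivial, hq⟩ := by
    intro p q hp hq hpq
    by_cases heq : p = q
    · subst heq
      exact .refl _
    · exact Adj.reachable (Subgraph.deleteVerts_adj.2
        ⟨trivial, hp, trivial, hq, hpq.imp_right fun hpq => ⟨hpq, heq⟩⟩)
  refine card_connectedComponent_le_of_forall_reachable
    (fun v => ⟨⟨v, copy v⟩, trivial, hcopy v⟩)
    (fun a b hab => hreach _ _ (hcopy a) (hcopy b) (.inl hab)) ?_
  rintro ⟨p, -, hp⟩
  have hpX : p.1 ∈ (({v | ∀ i, ⟨v, i⟩ ∈ X} : Finset V) : Set V)ᶜ := by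
    simpa using ⟨p.2, hp⟩
  exact ⟨⟨p.1, hpX⟩, hreach _ _ (hcopy _) hp (.inr rfl)⟩

theorem sum_filter_forall_mem_le_ncard (X : Set (Σ v, Fin (h v)))
    [DecidablePred (· ∈ X)] : ∑ v with ∀ i, ⟨v, i⟩ ∈ X, h v ≤ X.ncard := by
  have hcard : ∑ v with ∀ i, ⟨v, i⟩ ∈ X, h v =
      (({v | ∀ i, ⟨v, i⟩ ∈ X} : Finset V).sigma fun v => (Finset.univ : Finset (Fin (h v)))).card :=
    by simp
  rw [hcard, ← Set.ncard_coe_finset]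
  refine Set.ncard_le_ncard (fun p hp => ?_) X.toFinite
  exact (Finset.mem_filter.1 (Finset.mem_sigma.1 hp).1).2 p.2

theorem ComponentBound.exists_isPerfectMatching_blowUp {f : V → ℕ} (hH : ComponentBound H f)
    (hfh : ∀ v, f v ≤ h v + 1) (heven : Even (∑ v, h v)) :
    ∃ P : (blowUp H h).Subgraph, P.IsPerfectMatching := by
  classical
  refine tutte.2 fun X => not_isTutteViolator_of_card_connectedComponent_le (by simpa) ?_
  refine (card_connectedComponent_deleteVerts_blowUp_le X).trans ?_
  have hbound := hH {v | ∀ i, ⟨v, i⟩ ∈ X}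
  have hsum : ∑ v with ∀ i, ⟨v, i⟩ ∈ X, ((f v : ℤ) - 1) ≤ ∑ v with ∀ i, ⟨v, i⟩ ∈ X, (h v : ℤ) :=
    Finset.sum_le_sum fun v _ => by have := hfh v; omega
  have hX := sum_filter_forall_mem_le_ncard X
  rw [← Nat.cast_sum] at hsum
  omega

theorem ComponentBound.exists_degreeIn_add_two_mul_eq [DecidableEq V] {f : V → ℕ}
    (hH : ComponentBound H f) (hfh : ∀ v, f v ≤ h v + 1) (heven : Even (∑ v, h v)) :
    ∃ J : Multiset (Sym2 V), (∀ e ∈ J, e ∈ H.edgeSet) ∧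
      ∀ v, ∃ k, degreeIn J v + 2 * k = h v := by
  classical
  obtain ⟨P, hP⟩ := hH.exists_isPerfectMatching_blowUp hfh heven
  refine ⟨(P.spanningCoe.edgeFinset.val.map (Sym2.map Sigma.fst)).filter (¬·.IsDiag),
    fun e he => ?_, fun v => ⟨_, (degreeIn_filter_map_add P.spanningCoe Sigma.fst v).trans ?_⟩⟩
  · obtain ⟨hmap, hdiag⟩ := Multiset.mem_filter.1 he
    obtain ⟨e, heP, rfl⟩ := Multiset.mem_map.1 hmap
    induction e with | _ p q =>
    have hpq : (blowUp H h).Adj p q := P.spanningCoe_le ((mem_edgeSet _).1 (mem_edgeFinset.1 heP))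
    exact hpq.resolve_right fun hpq => hdiag hpq.1
  · have hdegree : ∀ p, P.spanningCoe.degree p = 1 := fun p =>
      Subgraph.degree_spanningCoe p |>.trans (Subgraph.isPerfectMatching_iff_forall_degree.1 hP p)
    have hfibre : ({p | p.1 = v} : Finset (Σ v, Fin (h v))) =
        ({v} : Finset V).sigma fun _ => .univ := by
      ext p
      simp
    simp [hdegree, hfibre]

end BlowUp

theorem ComponentBound.exists_closed_walk [Finite V] [DecidableEq V] [Nonempty V]
    {H M : SimpleGraph V} {f : V → ℕ} (hH : ComponentBound H f) (hf : ∀ v, 0 < f v) (hMH : M ≤ H)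
    (hM : ∀ v, (M.neighborSet v).Subsingleton) :
    ∃ (x : V) (p : H.Walk x x), (∀ v, v ∈ p.support) ∧ M.edgeSet ⊆ {e | e ∈ p.edges} ∧
      ∀ v, p.support.tail.count v ≤ f v := by
  classical
  cases nonempty_fintype V
  obtain ⟨T, ⟨hMT, hTH⟩, hT, hdegree⟩ := hH.exists_isTree hMH hM
  have hle : ∀ v, T.degree v ≤ 2 * f v := fun v => by have := hdegree v; have := hf v; omega
  obtain ⟨J, hJH, hJ⟩ := hH.exists_degreeIn_add_two_mul_eq (h := fun v => 2 * f v - T.degree v)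
    (fun v => by have := hdegree v; omega) <| by
      have hsum : ∑ v, (2 * f v - T.degree v) + ∑ v, T.degree v = 2 * ∑ v, f v := by
        rw [← Finset.sum_add_distrib, Finset.mul_sum]
        exact Finset.sum_congr rfl fun v _ => Nat.sub_add_cancel (hle v)
      rw [sum_degrees_eq_twice_card_edges] at hsum
      exact ⟨∑ v, f v - T.edgeFinset.card, by omega⟩
  let E := T.edgeFinset.val + J
  have hE : ∀ v, ∃ k, degreeIn E v + 2 * k = 2 * f v := fun v => by
    obtain ⟨k, hk⟩ := hJ v
    have := hle v
    refine ⟨k, ?_⟩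
    rw [degreeIn_add, degreeIn_edgeFinset]
    omega
  have hTE : ∀ e ∈ T.edgeSet, e ∈ E := fun e he =>
    Multiset.mem_add.2 (.inl (mem_edgeFinset.2 he))
  obtain ⟨x, p, hp, hspan⟩ := exists_closed_walk_edges_eq (H := H) (E := E)
    (fun e he => (Multiset.mem_add.1 he).elim
      (fun he => edgeSet_mono hTH (mem_edgeFinset.1 he)) (hJH e))
    (fun v => by obtain ⟨k, hk⟩ := hE v; exact ⟨f v - k, by omega⟩)
    (hT.connected.mono fun a b hab => (fromEdgeSet_adj _).2 ⟨hTE _ hab, hab.ne⟩)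
  refine ⟨x, p, hspan, fun e he => ?_, fun v => ?_⟩
  · exact Multiset.mem_coe.1 (hp ▸ hTE e (edgeSet_mono hMT he))
  · have hmeet := degreeIn_edges_add p v
    obtain ⟨k, hk⟩ := hE v
    rw [hp] at hmeet
    omega

section Multigraph

variable {α β : Type*} {G : Graph α β}

open scoped Classical in
theorem meetCount_le_max {x : α} (w : G.Walk x x) (v : α) :
    w.meetCount v ≤ max 1 (w.support.tail.count v) := by
  rw [Graph.Walk.meetCount]
  cases w with
  | nil hx => exact le_max_of_le_left (List.count_le_length (l := [x]))
  | cons e h p => exact le_max_right _ _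

/-- The simple graph of adjacency in a loopless multigraph. -/
def toSimple (G : Graph α β) [G.Loopless] : SimpleGraph G.vertexSet where
  Adj a b := G.Adj a b
  symm := ⟨fun _ _ h => h.symm⟩
  loopless := ⟨fun _ h => h.ne rfl⟩

/-- The simple graph of the pairs of vertices joined by an edge in `M`, so that a matching of `G`
becomes a subgraph of `toSimple G`. -/
def toSimpleOn (G : Graph α β) [G.Loopless] (M : Set β) : SimpleGraph G.vertexSet where
  Adj a b := ∃ e ∈ M, G.IsLink e a b
  symm := ⟨fun _ _ ⟨e, he, h⟩ => ⟨e, he, h.symm⟩⟩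
  loopless := ⟨fun _ ⟨_, _, h⟩ => h.adj.ne rfl⟩

theorem numComponents_le_of_isTough {n : ℕ} (hn : 1 ≤ n) (ht : G.IsTough (1 / ((n : ℝ) - 1)))
    (S : Finset α) (hS : (S : Set α) ⊆ G.vertexSet) :
    ((G.deleteVerts (S : Set α)).numComponents : ℤ) ≤ ∑ _v ∈ S, ((n : ℤ) - 1) + 1 := by
  have hn' : (0 : ℝ) ≤ n - 1 := sub_nonneg.2 (mod_cast hn)
  have hmul : (0 : ℝ) ≤ (n - 1) * S.card := by positivity
  have htough := ht S hS
  rw [one_div_one_div] at htough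
  have hreal : ((G.deleteVerts (S : Set α)).numComponents : ℝ) ≤ (n - 1) * S.card + 1 :=
    htough.trans (max_le (by linarith) (by linarith))
  rw [Finset.sum_const, nsmul_eq_mul, mul_comm]
  exact_mod_cast hreal

variable [G.Loopless]

theorem toSimpleOn_le (M : Set β) : toSimpleOn G M ≤ toSimple G :=
  fun _ _ ⟨e, _, h⟩ => ⟨e, h⟩

theorem neighborSet_toSimpleOn_subsingleton {M : Set β} (hM : G.IsEdgeMatching M)
    (v : G.vertexSet) : ((toSimpleOn G M).neighborSet v).Subsingleton := by
  rintro a ⟨e, he, hva⟩ b ⟨e', he', hvb⟩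
  obtain rfl := hM.eq_of_inc e he e' he' v hva.inc_left hvb.inc_left
  exact Subtype.ext (hva.right_unique hvb)

theorem exists_edge_choice {M : Set β} (hM : G.IsEdgeMatching M) :
    ∃ ε : (toSimple G).edgeSet → β, (∀ a b hab, G.IsLink (ε ⟨s(a, b), hab⟩) a b) ∧
      ∀ e ∈ M, ∃ e' : (toSimple G).edgeSet, e'.1 ∈ (toSimpleOn G M).edgeSet ∧ ε e' = e := by
  have hchoice : ∀ e : (toSimple G).edgeSet, ∃ e', ∀ a b, s(a, b) = e.1 → G.IsLink e' a b ∧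
      ∀ m ∈ M, G.IsLink m a b → e' = m := by
    rintro ⟨e, he⟩
    induction e with | _ a b =>
    obtain ⟨e', hlink, hmatch⟩ : ∃ e', G.IsLink e' a b ∧ ∀ m ∈ M, G.IsLink m a b → e' = m := by
      by_cases hab : ∃ m ∈ M, G.IsLink m a b
      · obtain ⟨e', he', hlink⟩ := hab
        exact ⟨e', hlink, fun m hm h => hM.eq_of_inc e' he' m hm a hlink.inc_left h.inc_left⟩
      · obtain ⟨e', hlink⟩ := he
        exact ⟨e', hlink, fun m hm h => absurd ⟨m, hm, h⟩ hab⟩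
    refine ⟨e', fun c d hcd => ?_⟩
    rcases Sym2.eq_iff.1 hcd with ⟨rfl, rfl⟩ | ⟨rfl, rfl⟩
    · exact ⟨hlink, hmatch⟩
    · exact ⟨hlink.symm, fun m hm h => hmatch m hm h.symm⟩
  choose ε hε using hchoice
  refine ⟨ε, fun a b hab => (hε _ a b rfl).1, fun e he => ?_⟩
  obtain ⟨a, b, hab⟩ := (G.edge_mem_iff_exists_isLink e).1 (hM.subset he)
  exact ⟨⟨s(⟨a, hab.left_mem⟩, ⟨b, hab.right_mem⟩), e, hab⟩, ⟨e, he, hab⟩,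
    (hε _ ⟨a, hab.left_mem⟩ ⟨b, hab.right_mem⟩ rfl).2 e he hab⟩

theorem exists_walk_of_walk_toSimple {ε : (toSimple G).edgeSet → β}
    (hε : ∀ a b hab, G.IsLink (ε ⟨s(a, b), hab⟩) a b) {x y : G.vertexSet}
    (p : (toSimple G).Walk x y) :
    ∃ w : G.Walk (x : α) y, w.support = p.support.map Subtype.val ∧
      ∀ e : (toSimple G).edgeSet, e.1 ∈ p.edges → ε e ∈ w.edges := by
  induction p with
  | nil => exact ⟨.nil (Subtype.property _), rfl, by simp⟩
  | @cons a b c hab p ih =>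
    obtain ⟨w, hsupport, hedges⟩ := ih
    refine ⟨.cons _ (hε a b hab) w, by simp [Graph.Walk.support, hsupport], ?_⟩
    rintro ⟨e, he⟩ hmem
    rcases List.mem_cons.1 hmem with rfl | hmem
    · exact List.mem_cons_self
    · exact List.mem_cons_of_mem _ (hedges ⟨e, he⟩ hmem)

theorem card_connectedComponent_induce_le_numComponents [Finite G.vertexSet] (S : Set α) :
    Nat.card ((toSimple G).induce (Subtype.val ⁻¹' S)ᶜ).ConnectedComponent ≤
      (G.deleteVerts S).numComponents := by
  have hfin : Finite (G.deleteVerts S).vertexSet :=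
    G.vertexSet.toFinite.subset ((G.vertexSet_deleteVerts S).trans_subset Set.sdiff_subset)
  have hmem : ∀ v : (G.deleteVerts S).vertexSet, v.1 ∈ G.vertexSet ∧ v.1 ∉ S := fun v =>
    (G.vertexSet_deleteVerts S).subset v.2
  let φ : (Quot fun a b : (G.deleteVerts S).vertexSet => (G.deleteVerts S).Adj a b) →
      ((toSimple G).induce (Subtype.val ⁻¹' S)ᶜ).ConnectedComponent :=
    Quot.lift (fun v => connectedComponentMk _ ⟨⟨v, (hmem v).1⟩, (hmem v).2⟩) fun a b hab =>
      ConnectedComponent.sound <| Adj.reachable <|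
        hab.imp fun e he => ((Graph.deleteVerts_isLink _ _).1 he).1
  refine Nat.card_le_card_of_surjective φ fun c => ?_
  induction c using ConnectedComponent.ind with
  | h v => exact ⟨Quot.mk _ ⟨v.1.1, (G.vertexSet_deleteVerts S).superset ⟨v.1.2, v.2⟩⟩, rfl⟩

theorem componentBound_toSimple [Finite G.vertexSet] {f : α → ℕ}
    (h : ∀ S : Finset α, (S : Set α) ⊆ G.vertexSet →
      ((G.deleteVerts (S : Set α)).numComponents : ℤ) ≤ ∑ v ∈ S, ((f v : ℤ) - 1) + 1) :
    ComponentBound (toSimple G) fun v => f v := by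
  intro D
  let S : Finset α := D.map (.subtype _)
  have hS : (S : Set α) = Subtype.val '' (D : Set G.vertexSet) := D.coe_map _
  have hcard := card_connectedComponent_induce_le_numComponents (G := G) (S : Set α)
  have hbound := h S (hS ▸ Subtype.coe_image_subset _ _)
  rw [hS, Set.preimage_image_eq _ Subtype.val_injective, ← hS] at hcard
  rw [Finset.sum_map] at hbound
  exact le_trans (Nat.cast_le.2 hcard) hbound

theorem exists_isFWalk_of_numComponents_le (hfin : G.vertexSet.Finite)
    (hne : G.vertexSet.Nonempty) {f : α → ℕ} (hf : ∀ v ∈ G.vertexSet, 0 < f v)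
    (h : ∀ S : Finset α, (S : Set α) ⊆ G.vertexSet →
      ((G.deleteVerts (S : Set α)).numComponents : ℤ) ≤ ∑ v ∈ S, ((f v : ℤ) - 1) + 1)
    {M : Set β} (hM : G.IsEdgeMatching M) :
    ∃ (x : α) (w : G.Walk x x), w.IsFWalk f ∧ ∀ e ∈ M, e ∈ w.edges := by
  classical
  have := hfin.fintype
  have := hne.to_subtype
  obtain ⟨x, p, hspan, hMp, hcount⟩ := (componentBound_toSimple h).exists_closed_walk
    (fun v => hf v v.2) (toSimpleOn_le M) (neighborSet_toSimpleOn_subsingleton hM)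
  obtain ⟨ε, hε, hεM⟩ := exists_edge_choice hM
  obtain ⟨w, hsupport, hedges⟩ := exists_walk_of_walk_toSimple hε p
  refine ⟨x, w, ⟨fun v hv => ?_, fun v hv => ?_⟩, fun e he => ?_⟩
  · exact hsupport ▸ List.mem_map_of_mem (hspan ⟨v, hv⟩)
  · refine (meetCount_le_max w v).trans (max_le (hf v hv) ?_)
    rw [hsupport, ← List.map_tail]
    refine (List.count_map_of_injective _ _ Subtype.val_injective ⟨v, hv⟩).trans_le ?_
    convert hcount ⟨v, hv⟩
  · obtain ⟨e', he', rfl⟩ := hεM e he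
    exact hedges e' (hMp he')

end Multigraph

end FWalk

theorem mainTheorem2 {α β : Type*} (G : Graph α β) [G.Loopless]
    (hfin : G.vertexSet.Finite) (hne : G.vertexSet.Nonempty) :
    (∀ f : α → ℕ, (∀ v ∈ G.vertexSet, 0 < f v) →
      (∀ S : Finset α, (S : Set α) ⊆ G.vertexSet →
        ((G.deleteVerts (S : Set α)).numComponents : ℤ) ≤ ∑ v ∈ S, ((f v : ℤ) - 1) + 1) →
      ∀ M : Set β, G.IsEdgeMatching M →
        ∃ (x : α) (w : G.Walk x x), w.IsFWalk f ∧ ∀ e ∈ M, e ∈ w.edges) ∧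
    (∀ n : ℕ, 2 ≤ n → G.IsTough (1 / ((n : ℝ) - 1)) →
      ∃ (x : α) (w : G.Walk x x), w.IsFWalk (fun _ => n)) := by
  refine ⟨fun f hf hbound M hM => FWalk.exists_isFWalk_of_numComponents_le hfin hne hf hbound hM,
    fun n hn htough => ?_⟩
  obtain ⟨x, w, hw, -⟩ := FWalk.exists_isFWalk_of_numComponents_le (f := fun _ => n) (M := ∅)
    hfin hne (fun _ _ => by omega) (FWalk.numComponents_le_of_isTough (by omega) htough)
    ⟨by simp, by simp⟩
  exact ⟨x, w, hw⟩
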